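/- Let $\mathcal A=\{A,B\}$ be a set of two parties with finite-dimensional Hilbert spaces $\mathcal H_A,\mathcal H_B$, and let $\rho=\rho_{AB}$ be a density operator on $\mathcal H_A\otimes\mathcal H_B$ with marginals (partial traces) $\rho_J$, $\varnothing\ne J\subseteq\mathcal A$. For $q>1$ let $S_q(J)=\frac{1}{1-q}(\operatorname{Tr}\rho_J^q-1)$ be the Tsallis entropy and $C_q(J)=\sum_{v\in J}S_q(\{v\})-S_q(J)$ the $q$-deformed total correlation, and let $$G_q(\varepsilon)=\{\varnothing\ne J\subseteq\mathcal A: C_q(J)\le\varepsilon\},\qquad \varepsilon\ge 0,$$ which is a filtration by simplicial complexes. Fix a field $K$ (for instance $\mathbb Z_2$) and use simplicial homology with coefficients in $K$. Let $\Delta_{\{A\}}$ be the complex whose only simplex is the vertex $\{A\}$, and for $k\ge 0$ put $$\beta_{q,k}^{\Delta_{\{A\}}}(\varepsilon)=\dim H_k\big(G_q(\varepsilon),\,G_q(\varepsilon)\cap\Delta_{\{A\}}\big),\qquad \widetilde\beta_{q,k}(\varepsilon)=\dim\widetilde H_k\big(G_q(\varepsilon)\big),$$ where $H_k(\cdot,\cdot)$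 is relative homology and $\widetilde H_k$ is reduced homology. The relative and the reduced integrated Euler characteristic are $$\mathfrak X_q^{\Delta_{\{A\}}}(\varepsilon)=\sum_{k\ge0}(-1)^k\int_0^{\varepsilon}\beta_{q,k}^{\Delta_{\{A\}}}(t)\,dt,\qquad \widetilde{\mathfrak X}_q(\varepsilon)=\sum_{k\ge0}(-1)^k\int_0^{\varepsilon}\widetilde\beta_{q,k}(t)\,dt .$$ Then for every $q>1$ the limits $\mathfrak X_q^{\Delta_{\{A\}}}(\infty)=\lim_{\varepsilon\to\infty}\mathfrak X_q^{\Delta_{\{A\}}}(\varepsilon)$ and $\widetilde{\mathfrak X}_q(\infty)=\lim_{\varepsilon\to\infty}\widetilde{\mathfrak X}_q(\varepsilon)$ exist and are finite, and $$\lim_{q\downarrow 1}\mathfrak X_q^{\Delta_{\{A\}}}(\infty)=\lim_{q\downarrow 1}\widetilde{\mathfrak X}_q(\infty)=I(A:B)_\rho\ge 0,$$ where $I(A:B)_\rho=S(\rho_A)+S(\rho_B)-S(\rho_{AB})$ is the mutual information and $S(\sigma)=-\operatorname{Tr}\sigma\log\sigma$ is the von Neumann entropy. -/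

import Mathlib

open scoped ComplexOrder

noncomputable section

namespace QPH

/-! ### Multipartite states, marginals and entropies -/

/-- Density matrices: positive semidefinite with unit trace. -/
def IsState {n : Type*} [Fintype n] (ρ : Matrix n n ℂ) : Prop :=
  ρ.PosSemidef ∧ ρ.trace = 1

/-- The marginal `ρ_J` of an operator on `⨂ i, ℂ^(d i)`: the partial trace over the parties
outside `J`. The basis of the tensor product is indexed by `∀ i, d i`. -/
def marginal {ι : Type*} [Fintype ι] [DecidableEq ι] {d : ι → Type*} [∀ i, Fintype (d i)]
    (ρ : Matrix (∀ i, d i) (∀ i, d i) ℂ) (J : Finset ι) :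
    Matrix (∀ i : {i // i ∈ J}, d i) (∀ i : {i // i ∈ J}, d i) ℂ :=
  fun x y => ∑ z : (∀ i : {i // i ∉ J}, d i),
    ρ ((Equiv.piEquivPiSubtypeProd (· ∈ J) d).symm (x, z))
      ((Equiv.piEquivPiSubtypeProd (· ∈ J) d).symm (y, z))

/-- Tsallis entropy `S_q(ρ) = (Tr ρ^q - 1) / (1 - q)`. -/
def tsallis {n : Type*} [Fintype n] [DecidableEq n] (q : ℝ) (ρ : Matrix n n ℂ) : ℝ :=
  (1 / (1 - q)) * ((cfc (fun x : ℝ => x ^ q) ρ).trace.re - 1)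

/-- Von Neumann entropy `S(ρ) = -Tr (ρ log ρ)` (natural logarithm, `0 log 0 = 0`). -/
def vonNeumann {n : Type*} [Fintype n] [DecidableEq n] (ρ : Matrix n n ℂ) : ℝ :=
  -(ρ * cfc Real.log ρ).trace.re

section Functionals

variable {ι : Type*} [Fintype ι] [DecidableEq ι] {d : ι → Type*} [∀ i, Fintype (d i)]
  [∀ i, DecidableEq (d i)]

/-- Mutual information `I(A:B) = S(A) + S(B) - S(AB)`. -/
def mutualInfo (ρ : Matrix (∀ i, d i) (∀ i, d i) ℂ) (A B : ι) : ℝ :=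
  vonNeumann (marginal ρ {A}) + vonNeumann (marginal ρ {B}) - vonNeumann (marginal ρ {A, B})

/-- The `q`-deformed total correlation `C_q(J) = ∑_{v ∈ J} S_q(v) - S_q(J)`. -/
def totalCorr (q : ℝ) (ρ : Matrix (∀ i, d i) (∀ i, d i) ℂ) (J : Finset ι) : ℝ :=
  ∑ v ∈ J, tsallis q (marginal ρ {v}) - tsallis q (marginal ρ J)

end Functionals

/-! ### Complexes and filtrations -/

/-- The sublevel filtration of a functional `F` on the nonempty subsets of `ι`. Its value at `ε` is
the largest simplicial complex all of whose faces `J` satisfy `F J ≤ ε`. If `F` is monotone, it is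
exactly `{J | F J ≤ ε}`, see `mem_sublevel_iff`; for the total correlation of two parties and
`0 ≤ ε` it is so in any case, see `mem_sublevel_totalCorr_iff`. -/
def sublevel {ι : Type*} (F : Finset ι → ℝ) (ε : ℝ) : PreAbstractSimplicialComplex ι where
  faces := {J | J.Nonempty ∧ ∀ I ⊆ J, I.Nonempty → F I ≤ ε}
  isRelLowerSet_faces := fun _ hJ =>
    ⟨hJ.1, fun _ hIJ hI => ⟨hI, fun _ hI' => hJ.2 _ (hI'.trans hIJ)⟩⟩

theorem mem_sublevel_iff {ι : Type*} (F : Finset ι → ℝ)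
    (hF : ∀ I J : Finset ι, I.Nonempty → I ⊆ J → F I ≤ F J) (ε : ℝ) (J : Finset ι) :
    J ∈ (sublevel F ε).faces ↔ J.Nonempty ∧ F J ≤ ε :=
  ⟨fun h => ⟨h.1, h.2 J subset_rfl h.1⟩, fun h => ⟨h.1, fun I hI hne => (hF I J hne hI).trans h.2⟩⟩

theorem mem_sublevel_totalCorr_iff {ι : Type*} [Fintype ι] [DecidableEq ι] {d : ι → Type*}
    [∀ i, Fintype (d i)] [∀ i, DecidableEq (d i)] (hι : Fintype.card ι = 2) (q : ℝ)
    (ρ : Matrix (∀ i, d i) (∀ i, d i) ℂ) {ε : ℝ} (hε : 0 ≤ ε) (J : Finset ι) :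
    J ∈ (sublevel (totalCorr q ρ) ε).faces ↔ J.Nonempty ∧ totalCorr q ρ J ≤ ε := by
  refine ⟨fun h => ⟨h.1, h.2 J subset_rfl h.1⟩, fun h => ⟨h.1, fun I hI hne => ?_⟩⟩
  rcases eq_or_ne I J with rfl | hIJ
  · exact h.2
  have h1 : I.card < J.card := Finset.card_lt_card (hI.ssubset_of_ne hIJ)
  have h2 : J.card ≤ 2 := hι ▸ Finset.card_le_univ J
  have h3 : 0 < I.card := hne.card_pos
  obtain ⟨v, rfl⟩ := Finset.card_eq_one.1 (show I.card = 1 by omega)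
  simpa [totalCorr] using hε

/-- The full simplex `Δ_S` on `S`: all nonempty subsets of `S`. -/
def fullSimplex {ι : Type*} (S : Finset ι) : PreAbstractSimplicialComplex ι where
  faces := {J | J.Nonempty ∧ J ⊆ S}
  isRelLowerSet_faces := fun _ hJ => ⟨hJ.1, fun _ hIJ hI => ⟨hI, hIJ.trans hJ.2⟩⟩

/-! ### Simplicial homology: reduced and relative -/

/-- The quotient `Z / B` of the cycles by the boundaries. -/
abbrev CyclesModBoundaries {K V : Type*} [Field K] [AddCommGroup V] [Module K V]
    (Z B : Submodule K V) : Type _ :=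
  Z ⧸ B.submoduleOf Z

section Homology

variable {ι : Type*} [LinearOrder ι] (K : Type*) [Field K]

/-- The `k`-simplices of a complex. -/
abbrev Simplex (G : PreAbstractSimplicialComplex ι) (k : ℕ) : Type _ :=
  {s : Finset ι // s ∈ G.faces ∧ s.card = k + 1}

/-- Simplicial `k`-chains with coefficients in `K`; a simplex is oriented by the order of `ι`. -/
abbrev Chain (G : PreAbstractSimplicialComplex ι) (k : ℕ) : Type _ :=
  Simplex G k →₀ K

/-- The face of a simplex obtained by omitting the vertex `v`. -/
def face {G : PreAbstractSimplicialComplex ι} {k : ℕ} (s : Simplex G (k + 1))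
    (v : {v // v ∈ s.1}) : Simplex G k :=
  ⟨s.1.erase v.1, by
    have hc : (s.1.erase v.1).card = k + 1 := by
      rw [Finset.card_erase_of_mem v.2, s.2.2]; rfl
    exact ⟨(G.isRelLowerSet_faces s.2.1).2 (Finset.erase_subset _ _)
      (Finset.card_pos.1 (by omega)), hc⟩⟩

/-- The boundary operator `∂ : C_{k+1} → C_k`, `∂ (v_0, …, v_{k+1}) = ∑ i, (-1)^i (…, v̂_i, …)`;
the position `i` of the vertex `v` is the number of smaller vertices of the simplex. -/
def boundary (G : PreAbstractSimplicialComplex ι) (k : ℕ) :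
    Chain K G (k + 1) →ₗ[K] Chain K G k :=
  Finsupp.linearCombination K fun s : Simplex G (k + 1) =>
    ∑ v : {v // v ∈ s.1},
      Finsupp.single (face s v) ((-1 : K) ^ (s.1.filter (· < v.1)).card)

/-- The augmentation `C_0 → K`, the sum of the coefficients. -/
def augmentation (G : PreAbstractSimplicialComplex ι) : Chain K G 0 →ₗ[K] K :=
  Finsupp.linearCombination K fun _ => (1 : K)

/-- Cycles of the augmented chain complex. -/
def redCycles (G : PreAbstractSimplicialComplex ι) : (k : ℕ) → Submodule K (Chain K G k)
  | 0 => LinearMap.ker (augmentation K G)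
  | k + 1 => LinearMap.ker (boundary K G k)

/-- Reduced homology in degree `k ≥ 0`. -/
abbrev redHomology (G : PreAbstractSimplicialComplex ι) (k : ℕ) : Type _ :=
  CyclesModBoundaries (redCycles K G k) (LinearMap.range (boundary K G k))

/-- Reduced Betti numbers. -/
def redBetti (G : PreAbstractSimplicialComplex ι) (k : ℕ) : ℕ :=
  Module.finrank K (redHomology K G k)

/-- The chains of a subcomplex `L` of `G`, inside the chains of `G`. -/
def subChain (G L : PreAbstractSimplicialComplex ι) (k : ℕ) : Submodule K (Chain K G k) :=
  Finsupp.supported K K {s | s.1 ∈ L.faces}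

/-- Relative chains `C_k(G) / C_k(L)`. -/
abbrev RelChain (G L : PreAbstractSimplicialComplex ι) (k : ℕ) : Type _ :=
  Chain K G k ⧸ subChain K G L k

theorem subChain_le_comap_boundary (G L : PreAbstractSimplicialComplex ι) (k : ℕ) :
    subChain K G L (k + 1) ≤ (subChain K G L k).comap (boundary K G k) := by
  rw [subChain, Finsupp.supported_eq_span_single, Submodule.span_le]
  rintro _ ⟨s, hs, rfl⟩
  simp only [Submodule.comap_coe, Set.mem_preimage, SetLike.mem_coe, boundary,
    Finsupp.linearCombination_single, one_smul]
  refine Submodule.sum_mem _ fun v _ => Finsupp.single_mem_supported K _ ?_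
  exact (L.isRelLowerSet_faces hs).2 (Finset.erase_subset _ _)
    ((G.isRelLowerSet_faces (face s v).2.1).1)

/-- The boundary operator induced on relative chains. -/
def relBoundary (G L : PreAbstractSimplicialComplex ι) (k : ℕ) :
    RelChain K G L (k + 1) →ₗ[K] RelChain K G L k :=
  Submodule.mapQ _ _ (boundary K G k) (subChain_le_comap_boundary K G L k)

/-- Relative cycles; every relative `0`-chain is a cycle. -/
def relCycles (G L : PreAbstractSimplicialComplex ι) : (k : ℕ) → Submodule K (RelChain K G L k)
  | 0 => ⊤
  | k + 1 => LinearMap.ker (relBoundary K G L k)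

/-- Relative homology `H_k(G, L)` for a subcomplex `L` of `G`. -/
abbrev relHomology (G L : PreAbstractSimplicialComplex ι) (k : ℕ) : Type _ :=
  CyclesModBoundaries (relCycles K G L k) (LinearMap.range (relBoundary K G L k))

/-- Relative Betti numbers. -/
def relBetti (G L : PreAbstractSimplicialComplex ι) (k : ℕ) : ℕ :=
  Module.finrank K (relHomology K G L k)

end Homology

/-! ### Topological summaries -/

/-- The integrated Betti number `𝔅_k(ε) = ∫_0^ε β_k(ε') dε'`. -/
def integratedBetti (β : ℝ → ℕ → ℕ) (k : ℕ) (ε : ℝ) : ℝ :=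
  ∫ t in (0 : ℝ)..ε, (β t k : ℝ)

/-- The integrated Euler characteristic `𝔛(ε) = ∑_{k ≥ 0} (-1)^k 𝔅_k(ε)` of a family of Betti
numbers (the sum is finite when the vertex set is finite). -/
def integratedEuler (β : ℝ → ℕ → ℕ) (ε : ℝ) : ℝ :=
  ∑' k : ℕ, (-1 : ℝ) ^ k * integratedBetti β k ε

section IEC

variable {ι : Type*} [Fintype ι] [LinearOrder ι] {d : ι → Type*} [∀ i, Fintype (d i)]
  [∀ i, DecidableEq (d i)] (K : Type*) [Field K]

/-- The reduced IEC at `ε` of the persistence complex of `C_q`. -/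
def redIEC (q : ℝ) (ρ : Matrix (∀ i, d i) (∀ i, d i) ℂ) (ε : ℝ) : ℝ :=
  integratedEuler (fun t => redBetti K (sublevel (totalCorr q ρ) t)) ε

/-- The IEC at `ε` of the persistence complex of `C_q`, relative to the full simplex `Δ_S`: it is
computed from `H_k(G(t), G(t) ∩ Δ_S)`. -/
def relIEC (q : ℝ) (ρ : Matrix (∀ i, d i) (∀ i, d i) ℂ) (S : Finset ι) (ε : ℝ) : ℝ :=
  integratedEuler
    (fun t => relBetti K (sublevel (totalCorr q ρ) t)
      (sublevel (totalCorr q ρ) t ⊓ fullSimplex S)) ε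

end IEC

end QPH

end

/-!
No homology group is computed. By the Euler–Poincaré formula the alternating sum of the Betti
numbers of `G(t)` is, up to sign, a sum of `(-1)^|J|` over simplices `J`, and `J` is counted exactly
for `t` beyond its entry time. Since the signs cancel once all simplices are present, integrating
over `t` shows that the integrated Euler characteristic is eventually constant, equal to the sum of
`(-1)^|J|` times the entry time of `J`. This sum runs over all `J` in the reduced case and over
`J ⊄ S` in the case relative to `Δ_S`.

For two parties only the pair `AB` enters late, at time `max (C_q(AB)) 0`. As `q → 1` the Tsallis
entropies converge to the von Neumann entropies, so this time converges to the mutual information,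
which is nonnegative by subadditivity: measuring `ρ_AB` in the product of the eigenbases of `ρ_A`
and `ρ_B` can only increase its entropy, and Shannon entropy is subadditive.
-/

namespace QPH

section EulerPoincare

open Finset Module

variable {K : Type*} [Field K]

theorem finrank_cyclesModBoundaries_add {V : Type*} [AddCommGroup V] [Module K V]
    [FiniteDimensional K V] {Z B : Submodule K V} (h : B ≤ Z) :
    finrank K (CyclesModBoundaries Z B) + finrank K B = finrank K Z := by
  rw [← (Submodule.submoduleOfEquivOfLe h).finrank_eq, Submodule.finrank_quotient_add_finrank]

theorem sum_neg_one_pow_mul_finrank_cyclesModBoundaries {C : ℕ → Type*}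
    [∀ k, AddCommGroup (C k)] [∀ k, Module K (C k)] [∀ k, FiniteDimensional K (C k)]
    (d : ∀ k, C (k + 1) →ₗ[K] C k) (Z : ∀ k, Submodule K (C k))
    (hZ : ∀ k, Z (k + 1) = LinearMap.ker (d k)) (hB : ∀ k, LinearMap.range (d k) ≤ Z k) (N : ℕ) :
    ∑ k ∈ range N, (-1 : ℤ) ^ k * finrank K (CyclesModBoundaries (Z k) (LinearMap.range (d k))) +
        (finrank K (C 0) - finrank K (Z 0)) =
      ∑ k ∈ range N, (-1 : ℤ) ^ k * finrank K (C k) +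
        (-1 : ℤ) ^ N * (finrank K (C N) - finrank K (Z N)) := by
  induction N with
  | zero => simp
  | succ N ih =>
    have homology := finrank_cyclesModBoundaries_add (hB N)
    have rank_nullity := (d N).finrank_range_add_finrank_ker
    rw [← hZ] at rank_nullity
    rw [sum_range_succ, sum_range_succ, add_right_comm, ih, ← homology, ← rank_nullity]
    push_cast
    ring

end EulerPoincare

section Chains

open Finset Module

variable {ι : Type*} [LinearOrder ι] (K : Type*) [Field K]

theorem boundary_single (G : PreAbstractSimplicialComplex ι) {k : ℕ} (s : Simplex G (k + 1)) :
    boundary K G k (Finsupp.single s 1) =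
      ∑ v : {v // v ∈ s.1}, Finsupp.single (face s v) ((-1 : K) ^ #{x ∈ s.1 | x < v.1}) := by
  rw [boundary, Finsupp.linearCombination_single, one_smul]

theorem neg_one_pow_card_filter_lt_mul_erase_eq_neg {s : Finset ι} {v w : ι} (hv : v ∈ s)
    (hw : w ∈ s) (hvw : v ≠ w) :
    (-1 : K) ^ #{x ∈ s | x < v} * (-1) ^ #{x ∈ s.erase v | x < w} =
      -((-1) ^ #{x ∈ s | x < w} * (-1) ^ #{x ∈ s.erase w | x < v}) := by
  wlog h : v < w generalizing v w
  · rw [this hw hv hvw.symm (hvw.symm.lt_of_le (not_lt.1 h)), neg_neg]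
  have hw' : #{x ∈ s.erase v | x < w} + 1 = #{x ∈ s | x < w} := by
    rw [filter_erase, card_erase_add_one (mem_filter.2 ⟨hv, h⟩)]
  have hv' : {x ∈ s.erase w | x < v} = {x ∈ s | x < v} := by
    rw [filter_erase, erase_eq_of_notMem (by simp [h.le])]
  rw [hv', ← hw', pow_succ]
  ring

/-- Deleting two vertices of a simplex in either order gives the same face with opposite signs. -/
theorem boundary_comp_boundary (G : PreAbstractSimplicialComplex ι) (k : ℕ) :
    boundary K G k ∘ₗ boundary K G (k + 1) = 0 := by
  refine Finsupp.lhom_ext' fun s => LinearMap.ext_ring ?_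
  have boundary_face (v : {v // v ∈ s.1}) :
      boundary K G k (Finsupp.single (face s v) ((-1 : K) ^ #{x ∈ s.1 | x < v.1})) =
        ∑ w : {w // w ∈ (face s v).1}, Finsupp.single (face (face s v) w)
          ((-1 : K) ^ #{x ∈ s.1 | x < v.1} * (-1) ^ #{x ∈ (face s v).1 | x < w.1}) := by
    rw [← mul_one ((-1 : K) ^ _), ← smul_eq_mul, ← Finsupp.smul_single, map_smul, boundary_single,
      smul_sum]
    simp only [Finsupp.smul_single, smul_eq_mul, mul_one]
  simp only [LinearMap.comp_apply, Finsupp.lsingle_apply, LinearMap.zero_apply, boundary_single,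
    map_sum, boundary_face]
  rw [sum_sigma']
  refine sum_involution (fun p _ => ⟨⟨p.2.1, mem_of_mem_erase p.2.2⟩, p.1.1,
    mem_erase.2 ⟨(ne_of_mem_erase p.2.2).symm, p.1.2⟩⟩) ?_ ?_ ?_ ?_
  · rintro ⟨v, w⟩ -
    have same_face : face (face s ⟨w.1, mem_of_mem_erase w.2⟩)
        ⟨v.1, mem_erase.2 ⟨(ne_of_mem_erase w.2).symm, v.2⟩⟩ = face (face s v) w :=
      Subtype.ext erase_right_comm
    rw [same_face, ← Finsupp.single_add, Finsupp.single_eq_zero]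
    exact add_eq_zero_iff_eq_neg.2 (neg_one_pow_card_filter_lt_mul_erase_eq_neg K v.2
      (mem_of_mem_erase w.2) (ne_of_mem_erase w.2).symm)
  · rintro ⟨v, w⟩ - - h
    exact ne_of_mem_erase w.2 (congrArg (fun p => p.1.1) h)
  · exact fun _ _ => mem_univ _
  · exact fun _ _ => rfl

theorem augmentation_comp_boundary (G : PreAbstractSimplicialComplex ι) :
    augmentation K G ∘ₗ boundary K G 0 = 0 := by
  refine Finsupp.lhom_ext' fun s => LinearMap.ext_ring ?_
  obtain ⟨v, w, hvw, hs⟩ := card_eq_two.1 s.2.2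
  simp only [LinearMap.comp_apply, Finsupp.lsingle_apply, LinearMap.zero_apply, boundary_single,
    map_sum, augmentation, Finsupp.linearCombination_single, smul_eq_mul, mul_one]
  rw [univ_eq_attach, sum_attach s.1 fun v => (-1 : K) ^ #{x ∈ s.1 | x < v}, hs, sum_pair hvw]
  rcases hvw.lt_or_gt with h | h <;> simp [filter_insert, filter_singleton, h, h.not_gt]

theorem relBoundary_comp_relBoundary (G L : PreAbstractSimplicialComplex ι) (k : ℕ) :
    relBoundary K G L k ∘ₗ relBoundary K G L (k + 1) = 0 := by
  refine Submodule.linearMap_qext _ ?_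
  rw [relBoundary, relBoundary, LinearMap.comp_assoc, Submodule.mapQ_mkQ, ← LinearMap.comp_assoc,
    Submodule.mapQ_mkQ, LinearMap.comp_assoc, boundary_comp_boundary, LinearMap.comp_zero,
    LinearMap.zero_comp]

theorem range_boundary_le_redCycles (G : PreAbstractSimplicialComplex ι) :
    ∀ k, LinearMap.range (boundary K G k) ≤ redCycles K G k
  | 0 => LinearMap.range_le_ker_iff.2 (augmentation_comp_boundary K G)
  | k + 1 => LinearMap.range_le_ker_iff.2 (boundary_comp_boundary K G k)

theorem range_relBoundary_le_relCycles (G L : PreAbstractSimplicialComplex ι) :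
    ∀ k, LinearMap.range (relBoundary K G L k) ≤ relCycles K G L k
  | 0 => le_top
  | k + 1 => LinearMap.range_le_ker_iff.2 (relBoundary_comp_relBoundary K G L k)

theorem finrank_chain_zero_sub_finrank_redCycles [Finite ι]
    {G : PreAbstractSimplicialComplex ι} {v : ι} (hv : {v} ∈ G.faces) :
    (finrank K (Chain K G 0) : ℤ) - finrank K (redCycles K G 0) = 1 := by
  have surjective : Function.Surjective (augmentation K G) := fun c =>
    ⟨Finsupp.single ⟨{v}, hv, card_singleton v⟩ c, by simp [augmentation]⟩
  rw [redCycles, ← (augmentation K G).finrank_range_add_finrank_ker,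
    LinearMap.range_eq_top.2 surjective, finrank_top, finrank_self]
  push_cast
  ring

end Chains

section Counting

open Finset Module

variable {ι : Type*} [Fintype ι] (K : Type*) [Field K]

open scoped Classical in
theorem finrank_chain (G : PreAbstractSimplicialComplex ι) (k : ℕ) :
    finrank K (Chain K G k) = #{J : Finset ι | J ∈ G.faces ∧ #J = k + 1} := by
  rw [finrank_finsupp_self, Fintype.card_subtype]

open scoped Classical in
theorem finrank_subChain (G L : PreAbstractSimplicialComplex ι) (k : ℕ) :
    finrank K (subChain K G L k) = #{J : Finset ι | (J ∈ G.faces ∧ #J = k + 1) ∧ J ∈ L.faces} := by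
  have basis := (Finsupp.supportedEquivFinsupp (M := K) (R := K)
    {s : Simplex G k | s.1 ∈ L.faces}).finrank_eq
  rw [subChain, basis, finrank_finsupp_self, Fintype.card_subtype,
    ← card_map (Function.Embedding.subtype _)]
  congr 1
  ext J
  simp [and_comm]

open scoped Classical in
theorem finrank_relChain (G L : PreAbstractSimplicialComplex ι) (k : ℕ) :
    finrank K (RelChain K G L k) =
      #{J : Finset ι | (J ∈ G.faces ∧ J ∉ L.faces) ∧ #J = k + 1} := by
  have quotient := Submodule.finrank_quotient_add_finrank (subChain K G L k)
  have split := card_filter_add_card_filter_not (s := {J | J ∈ G.faces ∧ #J = k + 1}) (· ∈ L.faces)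
  simp only [filter_filter] at split
  rw [finrank_subChain, finrank_chain, ← split, add_comm, Nat.add_left_cancel_iff] at quotient
  rw [quotient]
  exact congrArg card (filter_congr fun J _ => and_right_comm)

theorem isEmpty_simplex (G : PreAbstractSimplicialComplex ι) {k : ℕ} (hk : Fintype.card ι ≤ k) :
    IsEmpty (Simplex G k) :=
  ⟨fun s => by have := s.2.2; have := card_le_univ s.1; lia⟩

theorem empty_notMem_faces {ι : Type*} (G : PreAbstractSimplicialComplex ι) : ∅ ∉ G.faces :=
  fun h => Finset.not_nonempty_empty (G.isRelLowerSet_faces h).1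

theorem sum_neg_one_pow_mul_card_filter (T : Finset (Finset ι)) (hT : ∅ ∉ T) :
    ∑ k ∈ range (Fintype.card ι), (-1 : ℤ) ^ k * #{J ∈ T | #J = k + 1} =
      - ∑ J ∈ T, (-1 : ℤ) ^ #J := by
  have pos {J : Finset ι} (hJ : J ∈ T) : 0 < #J :=
    card_pos.2 (nonempty_iff_ne_empty.2 fun h => hT (h ▸ hJ))
  have card_sub_one_mem (J : Finset ι) (hJ : J ∈ T) : #J - 1 ∈ range (Fintype.card ι) :=
    mem_range.2 (by have := pos hJ; have := card_le_univ J; lia)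
  rw [← sum_fiberwise_of_maps_to card_sub_one_mem, ← sum_neg_distrib]
  refine sum_congr rfl fun k _ => ?_
  have fiber : {J ∈ T | #J - 1 = k} = {J ∈ T | #J = k + 1} :=
    filter_congr fun J hJ => by have := pos hJ; lia
  rw [fiber, sum_congr rfl fun J hJ => by rw [(mem_filter.1 hJ).2], sum_const, nsmul_eq_mul,
    pow_succ]
  ring

end Counting

section BettiSums

open Finset Module

variable {ι : Type*} [Fintype ι] [LinearOrder ι] (K : Type*) [Field K]

theorem redBetti_eq_zero (G : PreAbstractSimplicialComplex ι) {k : ℕ} (hk : Fintype.card ι ≤ k) :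
    redBetti K G k = 0 :=
  have := isEmpty_simplex G hk
  finrank_zero_of_subsingleton

theorem relBetti_eq_zero (G L : PreAbstractSimplicialComplex ι) {k : ℕ}
    (hk : Fintype.card ι ≤ k) : relBetti K G L k = 0 :=
  have := isEmpty_simplex G hk
  finrank_zero_of_subsingleton

open scoped Classical in
theorem sum_neg_one_pow_mul_redBetti {G : PreAbstractSimplicialComplex ι} {v : ι}
    (hv : {v} ∈ G.faces) :
    ∑ k ∈ range (Fintype.card ι), (-1 : ℤ) ^ k * redBetti K G k =
      -∑ J : Finset ι with J = ∅ ∨ J ∈ G.faces, (-1 : ℤ) ^ #J := by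
  have euler := sum_neg_one_pow_mul_finrank_cyclesModBoundaries (boundary K G) (redCycles K G)
    (fun _ => rfl) (range_boundary_le_redCycles K G) (Fintype.card ι)
  have := isEmpty_simplex G le_rfl
  have count := sum_neg_one_pow_mul_card_filter {J | J ∈ G.faces} (by simp [empty_notMem_faces])
  simp only [filter_filter, ← finrank_chain K] at count
  rw [finrank_chain_zero_sub_finrank_redCycles K hv, finrank_zero_of_subsingleton,
    finrank_zero_of_subsingleton, sub_self, mul_zero, add_zero, count] at euler
  rw [filter_or, filter_eq', if_pos (mem_univ _), ← insert_eq,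
    sum_insert (by simp [empty_notMem_faces]), card_empty, pow_zero, neg_add, ← euler,
    neg_add_cancel_comm_assoc]
  rfl

open scoped Classical in
theorem sum_neg_one_pow_mul_relBetti (G L : PreAbstractSimplicialComplex ι) :
    ∑ k ∈ range (Fintype.card ι), (-1 : ℤ) ^ k * relBetti K G L k =
      -∑ J : Finset ι with J ∈ G.faces ∧ J ∉ L.faces, (-1 : ℤ) ^ #J := by
  have euler := sum_neg_one_pow_mul_finrank_cyclesModBoundaries (C := RelChain K G L)
    (relBoundary K G L) (relCycles K G L) (fun _ => rfl)
    (range_relBoundary_le_relCycles K G L) (Fintype.card ι)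
  have := isEmpty_simplex G le_rfl
  have count := sum_neg_one_pow_mul_card_filter {J | J ∈ G.faces ∧ J ∉ L.faces}
    (by simp [empty_notMem_faces])
  simp only [filter_filter, ← finrank_relChain K] at count
  rw [relCycles, finrank_top, sub_self, add_zero, finrank_zero_of_subsingleton,
    finrank_zero_of_subsingleton, sub_self, mul_zero, add_zero, count] at euler
  exact euler

end BettiSums

section EntryTime

open Finset
open scoped NNReal

variable {ι : Type*}

/-- The time at which `J` enters the part `0 ≤ t` of the sublevel filtration of `F`: the least
`t ≥ 0` bounding `F` on all nonempty subsets of `J`. -/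
def entryTime (F : Finset ι → ℝ) (J : Finset ι) : ℝ≥0 :=
  {I ∈ J.powerset | I.Nonempty}.sup fun I => (F I).toNNReal

theorem entryTime_mono (F : Finset ι → ℝ) : Monotone (entryTime F) := fun _ _ h =>
  sup_mono (filter_subset_filter _ (powerset_mono.2 h))

theorem entryTime_empty (F : Finset ι → ℝ) : entryTime F ∅ = 0 := by
  simp [entryTime, filter_singleton]

theorem entryTime_le_iff {F : Finset ι → ℝ} {J : Finset ι} {t : ℝ} (ht : 0 ≤ t) :
    entryTime F J ≤ t ↔ ∀ I ⊆ J, I.Nonempty → F I ≤ t := by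
  lift t to ℝ≥0 using ht
  simp [entryTime, Real.toNNReal_le_iff_le_coe]

theorem mem_faces_sublevel_iff {F : Finset ι → ℝ} {J : Finset ι} {t : ℝ} (ht : 0 ≤ t) :
    J ∈ (sublevel F t).faces ↔ J.Nonempty ∧ entryTime F J ≤ t :=
  and_congr_right fun _ => (entryTime_le_iff ht).symm

theorem sublevel_mono (F : Finset ι → ℝ) : Monotone (sublevel F) := fun _ _ h _ hJ =>
  ⟨hJ.1, fun I hIJ hI => (hJ.2 I hIJ hI).trans h⟩

theorem tendsto_entryTime {α : Type*} {l : Filter α} {F : α → Finset ι → ℝ} {F₀ : Finset ι → ℝ}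
    (h : ∀ J, Filter.Tendsto (fun a => F a J) l (nhds (F₀ J))) (J : Finset ι) :
    Filter.Tendsto (fun a => entryTime (F a) J) l (nhds (entryTime F₀ J)) :=
  Filter.Tendsto.finset_sup_nhds_apply fun I _ => tendsto_real_toNNReal (h I)

end EntryTime

section Integrals

open Finset MeasureTheory

theorem intervalIntegrable_comp_of_monotone {P : Type*} [PartialOrder P] [Finite P] {G : ℝ → P}
    (hG : Monotone G) (f : P → ℝ) (a b : ℝ) :
    IntervalIntegrable (fun t => f (G t)) volume a b := by
  let _ : MeasurableSpace P := ⊤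
  have measurable : Measurable G := measurable_to_countable' fun p =>
    (Set.ordConnected_singleton.preimage_mono hG).measurableSet
  obtain ⟨C, hC⟩ := (Set.finite_range fun p => ‖f p‖).bddAbove
  exact (Measure.integrableOn_of_bounded (by simp)
    ((measurable_from_top (f := f)).comp measurable).aestronglyMeasurable
    (Filter.Eventually.of_forall fun t => hC ⟨G t, rfl⟩)).intervalIntegrable

theorem integratedEuler_eq_integral {β : ℝ → ℕ → ℕ} {N : ℕ} {ε : ℝ}
    (hN : ∀ t k, N ≤ k → β t k = 0)
    (hβ : ∀ k, IntervalIntegrable (fun t => (β t k : ℝ)) volume 0 ε) :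
    integratedEuler β ε = ∫ t in (0 : ℝ)..ε, ∑ k ∈ range N, (-1 : ℝ) ^ k * β t k := by
  rw [integratedEuler, tsum_eq_sum (s := range N), intervalIntegral.integral_finsetSum]
  · simp only [intervalIntegral.integral_const_mul, integratedBetti]
  · exact fun k _ => (hβ k).const_mul _
  · intro k hk
    simp [integratedBetti, hN _ k (not_lt.1 (mem_range.not.1 hk))]

theorem intervalIntegral_ite_le {e ε : ℝ} (he : 0 ≤ e) (heε : e ≤ ε) (c : ℝ) :
    ∫ t in (0 : ℝ)..ε, (if e ≤ t then c else 0) = c * (ε - e) := by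
  have support : Set.Icc 0 ε ∩ Set.Ici e = Set.Icc e ε := by
    rw [← Set.Ici_inter_Iic, Set.inter_right_comm, Set.Ici_inter_Ici, sup_of_le_right he,
      Set.Ici_inter_Iic]
  calc ∫ t in (0 : ℝ)..ε, (if e ≤ t then c else 0)
      = ∫ t in Set.Icc 0 ε, (Set.Ici e).indicator (fun _ => c) t := by
        rw [intervalIntegral.integral_of_le (he.trans heε), ← integral_Icc_eq_integral_Ioc]
        rfl
    _ = c * (ε - e) := by
        rw [setIntegral_indicator measurableSet_Ici, support, setIntegral_const,
          Real.volume_real_Icc_of_le heε, smul_eq_mul, mul_comm]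

theorem intervalIntegral_sum_filter_le {α : Type*} {T : Finset α} {c e : α → ℝ} {ε : ℝ}
    (hc : ∑ a ∈ T, c a = 0) (he : ∀ a ∈ T, 0 ≤ e a) (heε : ∀ a ∈ T, e a ≤ ε) :
    ∫ t in (0 : ℝ)..ε, ∑ a ∈ T with e a ≤ t, c a = -∑ a ∈ T, c a * e a := by
  have integrable (a : α) :
      IntervalIntegrable (fun t => if e a ≤ t then c a else 0) volume 0 ε := by
    classical
    exact intervalIntegrable_comp_of_monotone (P := Prop) (fun _ _ h => h.trans')
      (fun p => if p then c a else 0) 0 ε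
  calc ∫ t in (0 : ℝ)..ε, ∑ a ∈ T with e a ≤ t, c a
      = ∑ a ∈ T, ∫ t in (0 : ℝ)..ε, (if e a ≤ t then c a else 0) := by
        simp only [sum_filter]
        exact intervalIntegral.integral_finsetSum fun a _ => integrable a
    _ = ∑ a ∈ T, c a * (ε - e a) :=
        sum_congr rfl fun a ha => intervalIntegral_ite_le (he a ha) (heε a ha) (c a)
    _ = -∑ a ∈ T, c a * e a := by
        simp only [mul_sub, sum_sub_distrib, ← sum_mul, hc, zero_mul, zero_sub]

end Integrals

section IntegratedEuler

open Finset MeasureTheory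

instance {ι : Type*} [Finite ι] : Finite (PreAbstractSimplicialComplex ι) :=
  Finite.of_injective (fun G => G.faces) fun _ _ => PreAbstractSimplicialComplex.ext

variable {ι : Type*} [Fintype ι]

theorem integratedEuler_sublevel {b : PreAbstractSimplicialComplex ι → ℕ → ℕ} {N : ℕ}
    (hb : ∀ G k, N ≤ k → b G k = 0) {F : Finset ι → ℝ} {T : Finset (Finset ι)}
    (hT : ∑ J ∈ T, (-1 : ℝ) ^ #J = 0)
    (euler : ∀ t, 0 ≤ t → ∑ k ∈ range N, (-1 : ℤ) ^ k * b (sublevel F t) k =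
      -∑ J ∈ T with entryTime F J ≤ t, (-1 : ℤ) ^ #J)
    {ε : ℝ} (hε : entryTime F univ ≤ ε) :
    integratedEuler (fun t => b (sublevel F t)) ε = ∑ J ∈ T, (-1 : ℝ) ^ #J * entryTime F J := by
  have hε₀ : 0 ≤ ε := (entryTime F univ).2.trans hε
  have entryTime_le (J : Finset ι) : (entryTime F J : ℝ) ≤ ε :=
    (NNReal.coe_le_coe.2 (entryTime_mono F (subset_univ J))).trans hε
  calc integratedEuler (fun t => b (sublevel F t)) ε
      = ∫ t in (0 : ℝ)..ε, ∑ k ∈ range N, (-1 : ℝ) ^ k * b (sublevel F t) k :=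
        integratedEuler_eq_integral (fun t => hb _) fun k =>
          intervalIntegrable_comp_of_monotone (sublevel_mono F) (fun G => (b G k : ℝ)) 0 ε
    _ = ∫ t in (0 : ℝ)..ε, -∑ J ∈ T with entryTime F J ≤ t, (-1 : ℝ) ^ #J := by
        refine intervalIntegral.integral_congr fun t ht => ?_
        rw [Set.uIcc_of_le hε₀] at ht
        exact_mod_cast euler t ht.1
    _ = ∑ J ∈ T, (-1 : ℝ) ^ #J * entryTime F J := by
        rw [intervalIntegral.integral_neg, intervalIntegral_sum_filter_le hT
          (e := fun J => entryTime F J) (fun J _ => (entryTime F J).2) fun J _ => entryTime_le J,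
          neg_neg]

theorem sum_neg_one_pow_card_eq_zero [Nonempty ι] : ∑ J : Finset ι, (-1 : ℝ) ^ #J = 0 := by
  rw [← powerset_univ]
  exact_mod_cast sum_powerset_neg_one_pow_card_of_nonempty (univ_nonempty (α := ι))

theorem sum_filter_not_subset_neg_one_pow_card_eq_zero [DecidableEq ι] {S : Finset ι}
    (hS : S.Nonempty) : ∑ J : Finset ι with ¬ J ⊆ S, (-1 : ℝ) ^ #J = 0 := by
  have : Nonempty ι := hS.to_subtype.map Subtype.val
  have subsets : ∑ J : Finset ι with J ⊆ S, (-1 : ℝ) ^ #J = 0 := by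
    rw [filter_subset_univ]
    exact_mod_cast sum_powerset_neg_one_pow_card_of_nonempty hS
  rw [← sum_neg_one_pow_card_eq_zero (ι := ι), ← sum_filter_add_sum_filter_not univ (· ⊆ S),
    subsets, zero_add]

variable [LinearOrder ι] (K : Type*) [Field K]

theorem integratedEuler_redBetti_sublevel {F : Finset ι → ℝ} {v : ι} (hv : F {v} ≤ 0) {ε : ℝ}
    (hε : entryTime F univ ≤ ε) :
    integratedEuler (fun t => redBetti K (sublevel F t)) ε =
      ∑ J, (-1 : ℝ) ^ #J * entryTime F J := by
  classical
  have : Nonempty ι := ⟨v⟩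
  refine integratedEuler_sublevel (fun G _ => redBetti_eq_zero K G) sum_neg_one_pow_card_eq_zero
    (fun t ht => ?_) hε
  have vertex : {v} ∈ (sublevel F t).faces :=
    ⟨singleton_nonempty v, fun I hI hne => (hne.subset_singleton_iff.1 hI ▸ hv).trans ht⟩
  rw [sum_neg_one_pow_mul_redBetti K vertex]
  refine congrArg Neg.neg (sum_congr (ext fun J => ?_) fun _ _ => rfl)
  rw [mem_filter_univ, mem_filter_univ, mem_faces_sublevel_iff ht]
  rcases J.eq_empty_or_nonempty with rfl | hJ
  · simp [entryTime_empty, ht]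
  · simp [hJ, hJ.ne_empty]

theorem integratedEuler_relBetti_sublevel (F : Finset ι → ℝ) {S : Finset ι} (hS : S.Nonempty)
    {ε : ℝ} (hε : entryTime F univ ≤ ε) :
    integratedEuler (fun t => relBetti K (sublevel F t) (sublevel F t ⊓ fullSimplex S)) ε =
      ∑ J with ¬ J ⊆ S, (-1 : ℝ) ^ #J * entryTime F J := by
  classical
  refine integratedEuler_sublevel (b := fun G => relBetti K G (G ⊓ fullSimplex S))
    (fun G _ => relBetti_eq_zero K G _) (sum_filter_not_subset_neg_one_pow_card_eq_zero hS)
    (fun t ht => ?_) hε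
  rw [sum_neg_one_pow_mul_relBetti, filter_filter]
  refine congrArg Neg.neg (sum_congr (ext fun J => ?_) fun _ _ => rfl)
  have mem_inf : J ∈ (sublevel F t ⊓ fullSimplex S).faces ↔
      J ∈ (sublevel F t).faces ∧ J.Nonempty ∧ J ⊆ S := Iff.rfl
  rw [mem_filter_univ, mem_filter_univ, mem_inf, mem_faces_sublevel_iff ht]
  rcases J.eq_empty_or_nonempty with rfl | hJ
  · simp
  · simp only [hJ, true_and, not_and]
    tauto

end IntegratedEuler

section TotalCorrelation

open Finset

variable {ι : Type*} [Fintype ι] [LinearOrder ι] {d : ι → Type*} [∀ i, Fintype (d i)]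
  [∀ i, DecidableEq (d i)] (K : Type*) [Field K]

theorem tendsto_redIEC [Nonempty ι] (q : ℝ) (ρ : Matrix (∀ i, d i) (∀ i, d i) ℂ) :
    Filter.Tendsto (redIEC K q ρ) Filter.atTop
      (nhds (∑ J, (-1 : ℝ) ^ #J * entryTime (totalCorr q ρ) J)) :=
  tendsto_const_nhds.congr' <| (Filter.eventually_ge_atTop _).mono fun _ hε =>
    (integratedEuler_redBetti_sublevel K (v := Classical.arbitrary ι) (by simp [totalCorr]) hε).symm

theorem tendsto_relIEC (q : ℝ) (ρ : Matrix (∀ i, d i) (∀ i, d i) ℂ) {S : Finset ι}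
    (hS : S.Nonempty) :
    Filter.Tendsto (relIEC K q ρ S) Filter.atTop
      (nhds (∑ J with ¬ J ⊆ S, (-1 : ℝ) ^ #J * entryTime (totalCorr q ρ) J)) :=
  tendsto_const_nhds.congr' <| (Filter.eventually_ge_atTop _).mono fun _ hε =>
    (integratedEuler_relBetti_sublevel K _ hS hε).symm

end TotalCorrelation

section MatrixEntropy

open Matrix Finset

variable {n m : Type*} [Fintype n] [DecidableEq n] [Fintype m] [DecidableEq m]

theorem re_trace_cfc {M : Matrix n n ℂ} (hM : M.IsHermitian) (f : ℝ → ℝ) :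
    (cfc f M).trace.re = ∑ i, f (hM.eigenvalues i) := by
  rw [hM.cfc_eq, IsHermitian.cfc, Unitary.conjStarAlgAut_apply, trace_mul_cycle,
    Unitary.coe_star_mul_self, one_mul, trace_diagonal, Complex.re_sum]
  rfl

theorem vonNeumann_eq_sum_negMulLog_eigenvalues {M : Matrix n n ℂ} (hM : M.IsHermitian) :
    vonNeumann M = ∑ i, Real.negMulLog (hM.eigenvalues i) := by
  have continuous (f : ℝ → ℝ) : ContinuousOn f (spectrum ℝ M) :=
    (Matrix.finite_real_spectrum (A := M)).continuousOn f
  have mul_log : M * cfc Real.log M = cfc (fun x : ℝ => x * Real.log x) M := by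
    rw [cfc_mul (fun x : ℝ => x) Real.log M (continuous _) (continuous _),
      cfc_id' ℝ M hM.isSelfAdjoint]
  rw [vonNeumann, mul_log, re_trace_cfc hM, ← sum_neg_distrib]
  simp only [Real.negMulLog, neg_mul]

theorem vonNeumann_eq_sum_roots_charpoly {M : Matrix n n ℂ} (hM : M.IsHermitian) :
    vonNeumann M = (M.charpoly.roots.map fun z => Real.negMulLog z.re).sum := by
  rw [vonNeumann_eq_sum_negMulLog_eigenvalues hM, hM.roots_charpoly_eq_eigenvalues,
    Multiset.map_map]
  rfl

theorem vonNeumann_submatrix_equiv {M : Matrix n n ℂ} (hM : M.IsHermitian) (e : m ≃ n) :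
    vonNeumann (M.submatrix e e) = vonNeumann M := by
  rw [vonNeumann_eq_sum_roots_charpoly hM, vonNeumann_eq_sum_roots_charpoly (hM.submatrix e),
    ← charpoly_reindex e.symm]
  rfl

theorem IsState.sum_eigenvalues {M : Matrix n n ℂ} (hM : IsState M) :
    ∑ i, hM.1.1.eigenvalues i = 1 := by
  have trace := hM.2.symm.trans hM.1.1.trace_eq_sum_eigenvalues
  simpa using (congrArg Complex.re trace).symm

theorem hasDerivAt_const_rpow_one {x : ℝ} (hx : 0 ≤ x) :
    HasDerivAt (fun q : ℝ => x ^ q) (-Real.negMulLog x) 1 := by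
  rcases hx.eq_or_lt with rfl | hx
  · rw [Real.negMulLog_zero, neg_zero]
    refine (hasDerivAt_const (1 : ℝ) (0 : ℝ)).congr_of_eventuallyEq ?_
    exact (eventually_ne_nhds one_ne_zero).mono fun q hq => Real.zero_rpow hq
  · simpa [Real.negMulLog] using (Real.hasStrictDerivAt_const_rpow hx 1).hasDerivAt

/-- `q ↦ -S_q` is the slope at `1` of `q ↦ Tr ρ ^ q`, whose derivative there is `-S`. -/
theorem tendsto_tsallis {M : Matrix n n ℂ} (hM : IsState M) :
    Filter.Tendsto (fun q => tsallis q M) (nhdsWithin 1 {1}ᶜ) (nhds (vonNeumann M)) := by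
  have deriv : HasDerivAt (fun q : ℝ => ∑ i, hM.1.1.eigenvalues i ^ q)
      (∑ i, -Real.negMulLog (hM.1.1.eigenvalues i)) 1 :=
    HasDerivAt.fun_sum fun i _ => hasDerivAt_const_rpow_one (hM.1.eigenvalues_nonneg i)
  have slope := (hasDerivAt_iff_tendsto_slope.1 deriv).neg
  rw [sum_neg_distrib, neg_neg, ← vonNeumann_eq_sum_negMulLog_eigenvalues hM.1.1] at slope
  refine slope.congr fun q => ?_
  rw [tsallis, re_trace_cfc hM.1.1, slope_def_field]
  simp only [Real.rpow_one, hM.sum_eigenvalues]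
  rw [← neg_sub q 1, one_div, inv_neg, div_eq_inv_mul, neg_mul]

end MatrixEntropy

section Shannon

open Finset Real

theorem negMulLog_le_sub_mul_log {p r : ℝ} (hp : 0 ≤ p) (hr : 0 ≤ r) (hpr : r = 0 → p = 0) :
    negMulLog p ≤ r - p - p * log r := by
  rcases hp.eq_or_lt with rfl | hp
  · simpa using hr
  have hr : 0 < r := hr.lt_of_ne fun h => hp.ne' (hpr h.symm)
  have tangent := mul_le_mul_of_nonneg_left (log_le_sub_one_of_pos (div_pos hr hp)) hp.le
  rw [log_div hr.ne' hp.ne', mul_sub, mul_sub, mul_div_cancel₀ r hp.ne', mul_one] at tangent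
  rw [negMulLog]
  linarith

/-- Gibbs' inequality for `p` against the product of its marginals. -/
theorem sum_negMulLog_le_add {n m : Type*} [Fintype n] [Fintype m] {p : n → m → ℝ}
    (hp : ∀ x y, 0 ≤ p x y) (hsum : ∑ x, ∑ y, p x y = 1) :
    ∑ x, ∑ y, negMulLog (p x y) ≤
      ∑ x, negMulLog (∑ y, p x y) + ∑ y, negMulLog (∑ x, p x y) := by
  have sum_marginals : ∑ x, ∑ y, (∑ y', p x y') * (∑ x', p x' y) = 1 := by
    rw [← sum_mul_sum, hsum, sum_comm, hsum, one_mul]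
  have cross_left : ∑ x, ∑ y, p x y * log (∑ y', p x y') = -∑ x, negMulLog (∑ y, p x y) := by
    simp only [negMulLog, neg_mul, sum_neg_distrib, neg_neg, sum_mul]
  have cross_right : ∑ x, ∑ y, p x y * log (∑ x', p x' y) = -∑ y, negMulLog (∑ x, p x y) := by
    rw [sum_comm]
    simp only [negMulLog, neg_mul, sum_neg_distrib, neg_neg, sum_mul]
  have gibbs x y : negMulLog (p x y) ≤ (∑ y', p x y') * (∑ x', p x' y) - p x y
      - (p x y * log (∑ y', p x y') + p x y * log (∑ x', p x' y)) := by
    have le_left : p x y ≤ ∑ y', p x y' := single_le_sum (fun y _ => hp x y) (mem_univ y)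
    have le_right : p x y ≤ ∑ x', p x' y := single_le_sum (fun x _ => hp x y) (mem_univ x)
    rcases (hp x y).eq_or_lt with h | h
    · rw [← h] at le_left le_right ⊢
      simpa using mul_nonneg le_left le_right
    · have left_pos := h.trans_le le_left
      have right_pos := h.trans_le le_right
      rw [← mul_add, ← log_mul left_pos.ne' right_pos.ne']
      exact negMulLog_le_sub_mul_log h.le (mul_pos left_pos right_pos).le
        fun h0 => absurd h0 (mul_pos left_pos right_pos).ne'
  refine (sum_le_sum fun x _ => sum_le_sum fun y _ => gibbs x y).trans_eq ?_
  simp only [sum_sub_distrib, sum_add_distrib]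
  rw [sum_marginals, hsum, cross_left, cross_right]
  ring

end Shannon

section Measurement

open Matrix Finset

variable {n : Type*} [Fintype n]

theorem re_conjTranspose_mul_diagonal_mul_apply [DecidableEq n] {m : Type*} (V : Matrix n m ℂ)
    (l : n → ℝ) (i : m) :
    ((Vᴴ * diagonal (fun k => (l k : ℂ)) * V) i i).re = ∑ k, Complex.normSq (V k i) * l k := by
  rw [Matrix.mul_apply, Complex.re_sum]
  refine sum_congr rfl fun k _ => ?_
  rw [mul_diagonal, conjTranspose_apply, mul_right_comm, Complex.star_def,
    ← Complex.normSq_eq_conj_mul_self, ← Complex.ofReal_mul, Complex.ofReal_re]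

variable [DecidableEq n]

theorem sum_normSq_col {V : Matrix n n ℂ} (hV : V ∈ unitary (Matrix n n ℂ)) (i : n) :
    ∑ k, Complex.normSq (V k i) = 1 := by
  have gram : (Vᴴ * V) i i = 1 := by
    rw [← star_eq_conjTranspose, Unitary.star_mul_self_of_mem hV, one_apply_eq]
  simpa [Matrix.mul_apply, Complex.normSq_apply] using congrArg Complex.re gram

theorem sum_normSq_row {V : Matrix n n ℂ} (hV : V ∈ unitary (Matrix n n ℂ)) (k : n) :
    ∑ i, Complex.normSq (V k i) = 1 := by
  simpa [Complex.normSq_apply] using sum_normSq_col (Unitary.star_mem hV) k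

/-- The diagonal is the image of the spectrum under a doubly stochastic matrix, and `-x log x` is
concave. -/
theorem vonNeumann_le_sum_negMulLog_diag {M : Matrix n n ℂ} (hM : M.PosSemidef) {W : Matrix n n ℂ}
    (hW : W ∈ unitary (Matrix n n ℂ)) :
    vonNeumann M ≤ ∑ i, Real.negMulLog ((Wᴴ * M * W) i i).re := by
  set U : Matrix n n ℂ := hM.1.eigenvectorUnitary.1
  set l := hM.1.eigenvalues
  set V : Matrix n n ℂ := star U * W with hV
  have V_unitary : V ∈ unitary (Matrix n n ℂ) :=
    mul_mem (Unitary.star_mem hM.1.eigenvectorUnitary.2) hW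
  have spectral : M = U * diagonal (fun k => (l k : ℂ)) * star U := by
    have spectral := hM.1.spectral_theorem
    rwa [Unitary.conjStarAlgAut_apply] at spectral
  have diag_eq (i : n) : ((Wᴴ * M * W) i i).re = ∑ k, Complex.normSq (V k i) * l k := by
    rw [← re_conjTranspose_mul_diagonal_mul_apply, hV, spectral, conjTranspose_mul,
      ← star_eq_conjTranspose (star U), star_star]
    simp only [Matrix.mul_assoc]
  calc vonNeumann M = ∑ k, (∑ i, Complex.normSq (V k i)) * Real.negMulLog (l k) := by
        simp only [vonNeumann_eq_sum_negMulLog_eigenvalues hM.1, sum_normSq_row V_unitary,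
          one_mul, l]
    _ = ∑ i, ∑ k, Complex.normSq (V k i) * Real.negMulLog (l k) := by
        simp only [sum_mul]
        exact sum_comm
    _ ≤ ∑ i, Real.negMulLog ((Wᴴ * M * W) i i).re := by
        refine sum_le_sum fun i _ => ?_
        rw [diag_eq]
        exact Real.concaveOn_negMulLog.le_map_sum (fun k _ => Complex.normSq_nonneg _)
          (sum_normSq_col V_unitary i) fun k _ => hM.eigenvalues_nonneg k

theorem re_conjTranspose_eigenvectorUnitary_mul_mul_apply {M : Matrix n n ℂ} (hM : M.IsHermitian)
    (i : n) :
    (((hM.eigenvectorUnitary : Matrix n n ℂ)ᴴ * M * hM.eigenvectorUnitary) i i).re =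
      hM.eigenvalues i := by
  have diagonalized := hM.conjStarAlgAut_star_eigenvectorUnitary
  rw [Unitary.conjStarAlgAut_star_apply] at diagonalized
  rw [← star_eq_conjTranspose, diagonalized, diagonal_apply_eq]
  rfl

end Measurement

section PartialTrace

open Matrix
open scoped Kronecker

variable {R n m : Type*}

/-- The partial trace over the right factor of an operator on a tensor product whose basis is
indexed by `n × m`. -/
def partialTraceRight [AddCommMonoid R] [Fintype m] (X : Matrix (n × m) (n × m) R) :
    Matrix n n R :=
  of fun i j => ∑ k, X (i, k) (j, k)

/-- The partial trace over the left factor, obtained by exchanging the two factors. -/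
def partialTraceLeft [AddCommMonoid R] [Fintype n] (X : Matrix (n × m) (n × m) R) :
    Matrix m m R :=
  partialTraceRight (X.submatrix Prod.swap Prod.swap)

section CommSemiring

variable [CommSemiring R] [Fintype n] [Fintype m] (X : Matrix (n × m) (n × m) R)

theorem partialTraceRight_kronecker_one_mul [DecidableEq m] (A : Matrix n n R) :
    partialTraceRight ((A ⊗ₖ (1 : Matrix m m R)) * X) = A * partialTraceRight X := by
  ext i j
  simp only [partialTraceRight, of_apply, Matrix.mul_apply, Fintype.sum_prod_type,
    kroneckerMap_apply, one_apply, mul_ite, mul_one, mul_zero, ite_mul, zero_mul,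
    Finset.sum_ite_eq, Finset.mem_univ, if_true, Finset.mul_sum]
  exact Finset.sum_comm

theorem partialTraceRight_mul_kronecker_one [DecidableEq m] (A : Matrix n n R) :
    partialTraceRight (X * (A ⊗ₖ (1 : Matrix m m R))) = partialTraceRight X * A := by
  ext i j
  simp only [partialTraceRight, of_apply, Matrix.mul_apply, Fintype.sum_prod_type,
    kroneckerMap_apply, one_apply, mul_ite, mul_one, mul_zero,
    Finset.sum_ite_eq', Finset.mem_univ, if_true, Finset.sum_mul]
  exact Finset.sum_comm

theorem partialTraceRight_one_kronecker_mul_comm [DecidableEq n] (B : Matrix m m R) :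
    partialTraceRight (((1 : Matrix n n R) ⊗ₖ B) * X) =
      partialTraceRight (X * ((1 : Matrix n n R) ⊗ₖ B)) := by
  ext i j
  simp only [partialTraceRight, of_apply, Matrix.mul_apply, Fintype.sum_prod_type_right,
    kroneckerMap_apply, one_apply, mul_ite, ite_mul, one_mul, mul_zero, zero_mul,
    Finset.sum_ite_eq, Finset.sum_ite_eq', Finset.mem_univ, if_true]
  rw [Finset.sum_comm]
  simp only [mul_comm]

variable [StarRing R]

theorem partialTraceRight_conj_kronecker [DecidableEq m] (U : Matrix n n R) {V : Matrix m m R}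
    (hV : V ∈ unitary (Matrix m m R)) :
    partialTraceRight ((U ⊗ₖ V)ᴴ * X * (U ⊗ₖ V)) = Uᴴ * partialTraceRight X * U := by
  classical
  have split : U ⊗ₖ V = (1 ⊗ₖ V) * (U ⊗ₖ 1) := by
    rw [← mul_kronecker_mul, one_mul, mul_one]
  have unitary_right : ((1 : Matrix n n R) ⊗ₖ V) * (1 ⊗ₖ V)ᴴ = 1 := by
    rw [conjTranspose_kronecker, ← mul_kronecker_mul, conjTranspose_one, one_mul,
      ← star_eq_conjTranspose V, Unitary.mul_star_self_of_mem hV, one_kronecker_one]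
  calc partialTraceRight ((U ⊗ₖ V)ᴴ * X * (U ⊗ₖ V))
      = partialTraceRight ((Uᴴ ⊗ₖ 1) * ((1 ⊗ₖ Vᴴ) * (X * (1 ⊗ₖ V))) * (U ⊗ₖ 1)) := by
        rw [split, conjTranspose_mul, conjTranspose_kronecker, conjTranspose_kronecker,
          conjTranspose_one, conjTranspose_one]
        simp only [Matrix.mul_assoc]
    _ = Uᴴ * partialTraceRight (X * ((1 ⊗ₖ V) * (1 ⊗ₖ V)ᴴ)) * U := by
        rw [partialTraceRight_mul_kronecker_one, partialTraceRight_kronecker_one_mul,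
          partialTraceRight_one_kronecker_mul_comm, conjTranspose_kronecker, conjTranspose_one,
          Matrix.mul_assoc X]
    _ = Uᴴ * partialTraceRight X * U := by rw [unitary_right, Matrix.mul_one]

theorem partialTraceLeft_conj_kronecker [DecidableEq n] {U : Matrix n n R}
    (hU : U ∈ unitary (Matrix n n R)) (V : Matrix m m R) :
    partialTraceLeft ((U ⊗ₖ V)ᴴ * X * (U ⊗ₖ V)) = Vᴴ * partialTraceLeft X * V := by
  have swap : (U ⊗ₖ V).submatrix (Equiv.prodComm m n) (Equiv.prodComm m n) = V ⊗ₖ U := by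
    ext
    exact mul_comm _ _
  rw [partialTraceLeft, partialTraceLeft, ← partialTraceRight_conj_kronecker _ V hU, ← swap,
    conjTranspose_submatrix]
  change partialTraceRight (submatrix _ (Equiv.prodComm m n) (Equiv.prodComm m n)) =
    partialTraceRight (_ * submatrix _ (Equiv.prodComm m n) (Equiv.prodComm m n) * _)
  simp only [submatrix_mul_equiv]

end CommSemiring

theorem isHermitian_partialTraceRight [AddCommMonoid R] [StarAddMonoid R] [Fintype m]
    {X : Matrix (n × m) (n × m) R} (hX : X.IsHermitian) : (partialTraceRight X).IsHermitian := by
  ext i j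
  simp only [conjTranspose_apply, partialTraceRight, of_apply, star_sum, hX.apply]

end PartialTrace

section Subadditivity

open Matrix
open scoped Kronecker

variable {n m : Type*} [Fintype n] [DecidableEq n] [Fintype m] [DecidableEq m]

/-- Measuring in the product of the eigenbases of the two partial traces keeps their entropies and
can only increase the entropy of `M`, so Shannon's subadditivity applies. -/
theorem vonNeumann_le_add_partialTrace {M : Matrix (n × m) (n × m) ℂ} (hM : IsState M) :
    vonNeumann M ≤ vonNeumann (partialTraceRight M) + vonNeumann (partialTraceLeft M) := by
  have hermitian_left := isHermitian_partialTraceRight hM.1.1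
  have hermitian_right : (partialTraceLeft M).IsHermitian :=
    isHermitian_partialTraceRight (hM.1.1.submatrix Prod.swap)
  set U := hermitian_left.eigenvectorUnitary
  set V := hermitian_right.eigenvectorUnitary
  set W := U.1 ⊗ₖ V.1
  have W_unitary : W ∈ unitary _ := kronecker_mem_unitary U.2 V.2
  set p : n → m → ℝ := fun x y => ((Wᴴ * M * W) (x, y) (x, y)).re
  have p_nonneg x y : 0 ≤ p x y :=
    (Complex.le_def.1 ((hM.1.conjTranspose_mul_mul_same W).diag_nonneg (i := (x, y)))).1
  have p_sum : ∑ x, ∑ y, p x y = 1 := by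
    have trace : (Wᴴ * M * W).trace = 1 := by
      rw [trace_mul_cycle, ← star_eq_conjTranspose, Unitary.mul_star_self_of_mem W_unitary,
        one_mul, hM.2]
    rw [← Fintype.sum_prod_type', ← Complex.one_re, ← trace, Matrix.trace, Complex.re_sum]
    rfl
  have p_left x : ∑ y, p x y = hermitian_left.eigenvalues x := by
    rw [← re_conjTranspose_eigenvectorUnitary_mul_mul_apply,
      ← partialTraceRight_conj_kronecker M _ V.2, ← Complex.re_sum]
    rfl
  have p_right y : ∑ x, p x y = hermitian_right.eigenvalues y := by
    rw [← re_conjTranspose_eigenvectorUnitary_mul_mul_apply,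
      ← partialTraceLeft_conj_kronecker M U.2, ← Complex.re_sum]
    rfl
  calc vonNeumann M ≤ ∑ x, ∑ y, Real.negMulLog (p x y) := by
        rw [← Fintype.sum_prod_type']
        exact vonNeumann_le_sum_negMulLog_diag hM.1 W_unitary
    _ ≤ ∑ x, Real.negMulLog (∑ y, p x y) + ∑ y, Real.negMulLog (∑ x, p x y) :=
        sum_negMulLog_le_add p_nonneg p_sum
    _ = vonNeumann (partialTraceRight M) + vonNeumann (partialTraceLeft M) := by
        simp only [p_left, p_right]
        rw [vonNeumann_eq_sum_negMulLog_eigenvalues hermitian_left,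
          vonNeumann_eq_sum_negMulLog_eigenvalues hermitian_right]

end Subadditivity

section Marginals

open Matrix Finset

variable {ι : Type*} [DecidableEq ι] {d : ι → Type*}

/-- For disjoint `I` and `J`, a configuration of the parties outside `I` consists of one of the
parties in `J` and one of the parties outside `I ∪ J`. -/
def complPiEquiv {I J : Finset ι} (h : Disjoint I J) :
    ((∀ i : {i // i ∈ J}, d i) × (∀ i : {i // i ∉ I ∪ J}, d i)) ≃ ∀ i : {i // i ∉ I}, d i where
  toFun p i := if hi : i.1 ∈ J then p.1 ⟨i, hi⟩ else p.2 ⟨i, by simp [i.2, hi]⟩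
  invFun w := (fun i => w ⟨i, disjoint_right.1 h i.2⟩,
    fun i => w ⟨i, fun hi => i.2 (mem_union_left J hi)⟩)
  left_inv p := by
    refine Prod.ext (funext fun i => dif_pos i.2) (funext fun i => dif_neg fun hi => ?_)
    exact i.2 (mem_union_right I hi)
  right_inv w := by
    funext i
    by_cases hi : i.1 ∈ J <;> simp [hi]

variable [Fintype ι] [∀ i, Fintype (d i)]

theorem IsState.marginal {ρ : Matrix (∀ i, d i) (∀ i, d i) ℂ} (hρ : IsState ρ) (J : Finset ι) :
    IsState (marginal ρ J) := by
  set e := Equiv.piEquivPiSubtypeProd (· ∈ J) d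
  constructor
  · have sum_blocks : QPH.marginal ρ J =
        ∑ z, ρ.submatrix (fun x => e.symm (x, z)) (fun x => e.symm (x, z)) := by
      ext
      simp only [QPH.marginal, Matrix.sum_apply, submatrix_apply, e]
    rw [sum_blocks]
    exact posSemidef_sum _ fun z _ => hρ.1.submatrix _
  · rw [← hρ.2, Matrix.trace, Matrix.trace, ← e.symm.sum_comp, Fintype.sum_prod_type]
    rfl

theorem marginal_eq_partialTraceRight (ρ : Matrix (∀ i, d i) (∀ i, d i) ℂ) {I J T : Finset ι}
    (h : Disjoint I J) (hT : I ∪ J = T)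
    {e : ((∀ i : {i // i ∈ I}, d i) × (∀ i : {i // i ∈ J}, d i)) ≃ ∀ i : {i // i ∈ T}, d i}
    (he_left : ∀ x y i hi hi', e (x, y) ⟨i, hi'⟩ = x ⟨i, hi⟩)
    (he_right : ∀ x y i hi hi', e (x, y) ⟨i, hi'⟩ = y ⟨i, hi⟩) :
    marginal ρ I = partialTraceRight ((marginal ρ T).submatrix e e) := by
  subst hT
  have glue (x : ∀ i : {i // i ∈ I}, d i) (p : (∀ i : {i // i ∈ J}, d i) × _) :
      (Equiv.piEquivPiSubtypeProd (· ∈ I ∪ J) d).symm (e (x, p.1), p.2) =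
        (Equiv.piEquivPiSubtypeProd (· ∈ I) d).symm (x, complPiEquiv h p) := by
    funext i
    by_cases hI : i ∈ I
    · simp [hI, he_left, Equiv.piEquivPiSubtypeProd]
    · by_cases hJ : i ∈ J
      · simp [hI, hJ, he_right, Equiv.piEquivPiSubtypeProd, complPiEquiv]
      · simp [hI, hJ, Equiv.piEquivPiSubtypeProd, complPiEquiv]
  ext x x'
  simp only [partialTraceRight, of_apply, submatrix_apply, marginal]
  rw [← (complPiEquiv h).sum_comp, Fintype.sum_prod_type]
  simp only [← glue]

theorem IsState.submatrix_equiv {n m : Type*} [Fintype n] [Fintype m] {M : Matrix n n ℂ}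
    (hM : IsState M) (e : m ≃ n) : IsState (M.submatrix e e) :=
  ⟨hM.1.submatrix e, by rw [← hM.2]; exact e.sum_comp fun i => M i i⟩

variable [∀ i, DecidableEq (d i)]

theorem vonNeumann_marginal_union_le {ρ : Matrix (∀ i, d i) (∀ i, d i) ℂ} (hρ : IsState ρ)
    {I J : Finset ι} (h : Disjoint I J) :
    vonNeumann (marginal ρ (I ∪ J)) ≤ vonNeumann (marginal ρ I) + vonNeumann (marginal ρ J) := by
  set e := Equiv.piFinsetUnion d h
  set M := (marginal ρ (I ∪ J)).submatrix e e
  have left : marginal ρ I = partialTraceRight M :=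
    marginal_eq_partialTraceRight ρ h rfl (fun _ _ _ => Equiv.piFinsetUnion_left d h)
      fun _ _ _ => Equiv.piFinsetUnion_right d h
  have right : marginal ρ J = partialTraceLeft M :=
    marginal_eq_partialTraceRight (e := (Equiv.prodComm _ _).trans e) ρ h.symm (union_comm J I)
      (fun _ _ _ => Equiv.piFinsetUnion_right d h) fun _ _ _ => Equiv.piFinsetUnion_left d h
  rw [left, right, ← vonNeumann_submatrix_equiv (hρ.marginal _).1.1 e]
  exact vonNeumann_le_add_partialTrace ((hρ.marginal _).submatrix_equiv e)

theorem mutualInfo_nonneg {ρ : Matrix (∀ i, d i) (∀ i, d i) ℂ} (hρ : IsState ρ) {A B : ι}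
    (hAB : A ≠ B) : 0 ≤ mutualInfo ρ A B := by
  have subadditive := vonNeumann_marginal_union_le hρ (disjoint_singleton.2 hAB)
  rw [← insert_eq] at subadditive
  exact sub_nonneg.2 subadditive

/-- The total correlation `∑_{v ∈ J} S(v) - S(J)`, the case `q = 1` of `totalCorr`; for a pair of
parties it is their mutual information. -/
noncomputable def vonNeumannTotalCorr (ρ : Matrix (∀ i, d i) (∀ i, d i) ℂ) (J : Finset ι) : ℝ :=
  ∑ v ∈ J, vonNeumann (marginal ρ {v}) - vonNeumann (marginal ρ J)

theorem vonNeumannTotalCorr_singleton (ρ : Matrix (∀ i, d i) (∀ i, d i) ℂ) (v : ι) :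
    vonNeumannTotalCorr ρ {v} = 0 := by
  rw [vonNeumannTotalCorr, sum_singleton, sub_self]

theorem vonNeumannTotalCorr_pair (ρ : Matrix (∀ i, d i) (∀ i, d i) ℂ) {A B : ι} (hAB : A ≠ B) :
    vonNeumannTotalCorr ρ {A, B} = mutualInfo ρ A B := by
  rw [vonNeumannTotalCorr, sum_pair hAB, mutualInfo]

theorem tendsto_totalCorr {ρ : Matrix (∀ i, d i) (∀ i, d i) ℂ} (hρ : IsState ρ) (J : Finset ι) :
    Filter.Tendsto (fun q => totalCorr q ρ J) (nhdsWithin 1 {1}ᶜ)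
      (nhds (vonNeumannTotalCorr ρ J)) :=
  (tendsto_finsetSum _ fun v _ => tendsto_tsallis (hρ.marginal {v})).sub
    (tendsto_tsallis (hρ.marginal J))

end Marginals

section TwoParties

open Finset

theorem eq_pair_of_one_lt_card {ι : Type*} [DecidableEq ι] {A B : ι}
    (hparties : ∀ i, i = A ∨ i = B) {J : Finset ι} (hJ : 1 < #J) : J = {A, B} :=
  eq_of_subset_of_card_le (fun i _ => by simpa using hparties i) (card_le_two.trans hJ)

theorem entryTime_eq_zero_of_card_le_one {ι : Type*} {F : Finset ι → ℝ} (hF : ∀ v, F {v} ≤ 0)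
    {J : Finset ι} (hJ : #J ≤ 1) : entryTime F J = 0 := by
  rw [← nonpos_iff_eq_zero, ← NNReal.coe_le_coe, NNReal.coe_zero, entryTime_le_iff le_rfl]
  intro I hIJ hI
  obtain ⟨v, rfl⟩ := card_eq_one.1 (((card_le_card hIJ).trans hJ).antisymm hI.card_pos)
  exact hF v

theorem entryTime_pair {ι : Type*} [DecidableEq ι] {F : Finset ι → ℝ} (hF : ∀ v, F {v} ≤ 0)
    {A B : ι} (hAB : A ≠ B) : (entryTime F {A, B} : ℝ) = max (F {A, B}) 0 := by
  refine le_antisymm ((entryTime_le_iff (le_max_right _ _)).2 fun I hI hne => ?_)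
    (max_le ((entryTime_le_iff NNReal.zero_le_coe).1 le_rfl _ subset_rfl (by simp))
      NNReal.zero_le_coe)
  rcases eq_or_ne I {A, B} with rfl | hI'
  · exact le_max_left _ _
  · have card_lt := card_pair hAB ▸ card_lt_card (hI.ssubset_of_ne hI')
    obtain ⟨v, rfl⟩ := card_eq_one.1 ((Nat.le_of_lt_succ card_lt).antisymm hne.card_pos)
    exact (hF v).trans (le_max_right _ _)

theorem sum_entryTime_of_two_parties {ι : Type*} [DecidableEq ι] {A B : ι} (hAB : A ≠ B)
    (hparties : ∀ i, i = A ∨ i = B) {F : Finset ι → ℝ} (hF : ∀ v, F {v} ≤ 0)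
    {s : Finset (Finset ι)} (hs : {A, B} ∈ s) :
    ∑ J ∈ s, (-1 : ℝ) ^ #J * entryTime F J = max (F {A, B}) 0 := by
  rw [sum_eq_single_of_mem _ hs, card_pair hAB, entryTime_pair hF hAB, neg_one_sq, one_mul]
  intro J _ hJ
  rw [entryTime_eq_zero_of_card_le_one hF, NNReal.coe_zero, mul_zero]
  exact not_lt.1 (mt (eq_pair_of_one_lt_card hparties) hJ)

theorem sum_entryTime_vonNeumannTotalCorr {ι : Type*} [Fintype ι] [DecidableEq ι]
    {d : ι → Type*} [∀ i, Fintype (d i)] [∀ i, DecidableEq (d i)] {A B : ι} (hAB : A ≠ B)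
    (hparties : ∀ i, i = A ∨ i = B) {ρ : Matrix (∀ i, d i) (∀ i, d i) ℂ} (hρ : IsState ρ)
    {s : Finset (Finset ι)} (hs : {A, B} ∈ s) :
    ∑ J ∈ s, (-1 : ℝ) ^ #J * entryTime (vonNeumannTotalCorr ρ) J = mutualInfo ρ A B := by
  rw [sum_entryTime_of_two_parties hAB hparties (fun v => (vonNeumannTotalCorr_singleton ρ v).le)
    hs, vonNeumannTotalCorr_pair ρ hAB, max_eq_left (mutualInfo_nonneg hρ hAB)]

end TwoParties

end QPH

open Finset QPH in
theorem mainTheorem6_general (K : Type*) [Field K] {ι : Type*} [Fintype ι] [LinearOrder ι]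
    {d : ι → Type*} [∀ i, Fintype (d i)] [∀ i, DecidableEq (d i)]
    {S : Finset ι} (hS : S.Nonempty)
    {ρ : Matrix (∀ i, d i) (∀ i, d i) ℂ} (hρ : IsState ρ) :
    ∃ Xrel Xred : ℝ → ℝ,
      (∀ q, 0 < q → q ≠ 1 → Filter.Tendsto (relIEC K q ρ S) Filter.atTop (nhds (Xrel q))) ∧
      (∀ q, 0 < q → q ≠ 1 → Filter.Tendsto (redIEC K q ρ) Filter.atTop (nhds (Xred q))) ∧
      Filter.Tendsto Xrel (nhdsWithin 1 {1}ᶜ)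
        (nhds (∑ J with ¬ J ⊆ S, (-1) ^ #J * entryTime (vonNeumannTotalCorr ρ) J)) ∧
      Filter.Tendsto Xred (nhdsWithin 1 {1}ᶜ)
        (nhds (∑ J, (-1) ^ #J * entryTime (vonNeumannTotalCorr ρ) J)) := by
  have : Nonempty ι := hS.to_type
  have tendsto_sum (s : Finset (Finset ι)) : Filter.Tendsto
      (fun q => ∑ J ∈ s, (-1 : ℝ) ^ #J * entryTime (totalCorr q ρ) J) (nhdsWithin 1 {1}ᶜ)
      (nhds (∑ J ∈ s, (-1) ^ #J * entryTime (vonNeumannTotalCorr ρ) J)) :=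
    tendsto_finsetSum _ fun J _ => tendsto_const_nhds.mul
      ((NNReal.continuous_coe.tendsto _).comp (tendsto_entryTime (tendsto_totalCorr hρ) J))
  exact ⟨_, _, fun q _ _ => tendsto_relIEC K q ρ hS, fun q _ _ => tendsto_redIEC K q ρ,
    tendsto_sum _, tendsto_sum _⟩

theorem mainTheorem6 (K : Type*) [Field K] {ι : Type*} [Fintype ι] [LinearOrder ι]
    {d : ι → Type*} [∀ i, Fintype (d i)] [∀ i, DecidableEq (d i)]
    (A B : ι) (hAB : A ≠ B) (hparties : ∀ i, i = A ∨ i = B)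
    (ρ : Matrix (∀ i, d i) (∀ i, d i) ℂ) (hρ : QPH.IsState ρ) :
    ∃ Xrel Xred : ℝ → ℝ,
      (∀ q : ℝ, 1 < q →
        Filter.Tendsto (fun ε => QPH.relIEC K q ρ {A} ε) Filter.atTop (nhds (Xrel q))) ∧
      (∀ q : ℝ, 1 < q →
        Filter.Tendsto (fun ε => QPH.redIEC K q ρ ε) Filter.atTop (nhds (Xred q))) ∧
      Filter.Tendsto Xrel (nhdsWithin 1 (Set.Ioi 1)) (nhds (QPH.mutualInfo ρ A B)) ∧
      Filter.Tendsto Xred (nhdsWithin 1 (Set.Ioi 1)) (nhds (QPH.mutualInfo ρ A B)) ∧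
      0 ≤ QPH.mutualInfo ρ A B := by
  obtain ⟨Xrel, Xred, hrel, hred, hXrel, hXred⟩ :=
    mainTheorem6_general K (Finset.singleton_nonempty A) hρ
  rw [QPH.sum_entryTime_vonNeumannTotalCorr hAB hparties hρ] at hXrel hXred
  · exact ⟨Xrel, Xred, fun q hq => hrel q (one_pos.trans hq) hq.ne',
      fun q hq => hred q (one_pos.trans hq) hq.ne', hXrel.mono_left (nhdsGT_le_nhdsNE 1),
      hXred.mono_left (nhdsGT_le_nhdsNE 1), QPH.mutualInfo_nonneg hρ hAB⟩
  · exact Finset.mem_univ _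
  · exact (Finset.mem_filter_univ _).2 fun h =>
      hAB (Finset.mem_singleton.1 (h (Finset.mem_insert_of_mem (Finset.mem_singleton_self B)))).symm
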